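/- Let $\mathcal X$ be a non-empty set, let $B$ be a finite-dimensional complex Hilbert space with state space $\mathcal S(B)$, let $W:\mathcal X\to\mathcal S(B)$, $x\mapsto W_x$, be a classical-quantum channel, and write $W_{x^n}=W_{x_1}\otimes\cdots\otimes W_{x_n}$ for $x^n\in\mathcal X^n$. An $(n,N,\lambda_1,\lambda_2)$ deterministic identification (DI) code for $W$ consists of code words $u_1,\dots,u_N\in\mathcal X^n$ and operators $0\le T_1,\dots,T_N\le \mathbb 1$ on $B^{\otimes n}$ with $\operatorname{Tr} W_{u_j}T_j\ge 1-\lambda_1$ for all $j$ and $\operatorname{Tr} W_{u_j}T_k\le\lambda_2$ for all $j\ne k$. Its rate is $R=\frac1n\log_2 N$, and, for a fixed base $b>1$ of the logarithm, its error exponents are $E_i=\frac1n\log_b\frac1{\lambda_i}$, $i=1,2$ (with $E_i=+\infty$ if $\lambda_i=0$). Let $\sqrt{\widetilde{\mathcal X}}=\{\sqrt{W_x}:x\in\mathcal X\}$, and let $\Gamma_\delta(\sqrt{\widetilde{\mathcal X}})$ be the minimum number of closed balls of radius $\delta$ in Hilbert-Schmidt distance, centred at points of $\sqrt{\widetilde{\mathcal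 X}}$, whose union contains $\sqrt{\widetilde{\mathcal X}}$. Theorem. Let $E>0$ and let $n$ be large enough that $4\,b^{-nE}\le e^{-nE/2}$ (for $b=e$ this says $nE\ge 2\ln 4$). Then for every DI code for $W$ of block length $n$ whose error exponents satisfy $E_1,E_2\ge E$, the number $\Gamma_{\frac12\sqrt{1-e^{-E/2}}}(\sqrt{\widetilde{\mathcal X}})$ is finite and $$R\le\log_2\Gamma_{\frac12\sqrt{1-e^{-E/2}}}\bigl(\sqrt{\widetilde{\mathcal X}}\bigr).$$ -/

import Mathlib

open scoped ComplexOrder MatrixOrder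

/-- A quantum state on the finite-dimensional Hilbert space `ℂ^d`: a positive semidefinite matrix
of trace one. -/
def IsDensityMatrix {d : Type*} [Fintype d] (ρ : Matrix d d ℂ) : Prop :=
  ρ.PosSemidef ∧ ρ.trace = 1

/-- A classical-quantum channel with input alphabet `X` (an arbitrary set) and output system
`ℂ^d`. -/
structure CQChannel (X d : Type*) [Fintype d] where
  state : X → Matrix d d ℂ
  isDensityMatrix : ∀ x, IsDensityMatrix (state x)

/-- The tensor product `ρ₁ ⊗ ⋯ ⊗ ρₙ`, as a matrix on `(ℂ^d)^{⊗ n}` with the product basis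
indexed by `Fin n → d`. -/
def matrixTensor {d : Type*} {n : ℕ} (ρ : Fin n → Matrix d d ℂ) :
    Matrix (Fin n → d) (Fin n → d) ℂ :=
  Matrix.of fun i j => ∏ k, ρ k (i k) (j k)

namespace CQChannel

variable {X d : Type*} [Fintype d]

/-- The output state `W_{u₁} ⊗ ⋯ ⊗ W_{uₙ}` of the memoryless extension on the input word `u`. -/
def wordState (W : CQChannel X d) {n : ℕ} (u : Fin n → X) : Matrix (Fin n → d) (Fin n → d) ℂ :=
  matrixTensor fun k => W.state (u k)

/-- An `(n, N, lam₁, lam₂)` deterministic identification code: code words `u_j` and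
tests `0 ≤ T_j ≤ 1` on the output system (arbitrary, not necessarily arising from one common
measurement), with missed identification probabilities at most `lam₁` and wrong identification
probabilities at most `lam₂`. -/
structure DICode [DecidableEq d] (W : CQChannel X d) (n N : ℕ) (lam₁ lam₂ : ℝ) where
  word : Fin N → Fin n → X
  test : Fin N → Matrix (Fin n → d) (Fin n → d) ℂ
  test_nonneg : ∀ j, (test j).PosSemidef
  test_le_one : ∀ j, (1 - test j).PosSemidef
  missed_le : ∀ j, 1 - lam₁ ≤ (W.wordState (word j) * test j).trace.re
  wrong_le : ∀ j k, j ≠ k → (W.wordState (word j) * test k).trace.re ≤ lam₂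

/-- The set of positive semidefinite square roots of the output states. -/
noncomputable def sqrtOutputs [DecidableEq d] (W : CQChannel X d) : Set (Matrix d d ℂ) :=
  Set.range fun x => CFC.sqrt (W.state x)

end CQChannel

/-- The covering number for the Hilbert-Schmidt distance: the least number of closed balls of
radius `δ`, centred at points of `F`, whose union contains `F`. -/
noncomputable def hsCoveringNumber {d : Type*} [Fintype d] (δ : ℝ) (F : Set (Matrix d d ℂ)) : ℕ∞ :=
  letI : NormedAddCommGroup (Matrix d d ℂ) := Matrix.frobeniusNormedAddCommGroup
  Metric.coveringNumber δ.toNNReal F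

/-- The rate `(1/n) log₂ N`. -/
noncomputable def codeRate (n N : ℕ) : ℝ := 1 / (n : ℝ) * Real.logb 2 N

/-- The error exponent `(1/n) log_b (1/lam)` with respect to the base `b`, equal to `+∞` when the
error is zero. -/
noncomputable def errorExponent (b : ℝ) (n : ℕ) (lam : ℝ) : EReal :=
  if lam ≤ 0 then ⊤ else ((1 / (n : ℝ) * Real.logb b (1 / lam) : ℝ) : EReal)

open Matrix

section MatrixTensor

variable {d : Type*} {n : ℕ}

/-! A test separating two states with small errors forces their square roots to have small overlap
`Tr √ρ √σ` (`re_trace_mul_le_of_test`). This overlap is multiplicative over tensor products, so two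
distinct code words must have small overlap at some letter (`DICode.exists_re_trace_sqrt_le`).
Letters whose square roots lie in a common ball of a `δ`-cover have large overlap
(`exists_cells_of_isHermitian`). Hence replacing each letter by its cell is injective on code words,
and `N ≤ Γ ^ n`. -/

theorem matrixTensor_mul [Fintype d] (ρ σ : Fin n → Matrix d d ℂ) :
    matrixTensor ρ * matrixTensor σ = matrixTensor fun k => ρ k * σ k := by
  ext i j
  simp only [matrixTensor, Matrix.mul_apply, Matrix.of_apply, ← Finset.prod_mul_distrib]
  exact (Fintype.prod_sum fun k l => ρ k (i k) l * σ k l (j k)).symm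

theorem trace_matrixTensor [Fintype d] (ρ : Fin n → Matrix d d ℂ) :
    (matrixTensor ρ).trace = ∏ k, (ρ k).trace := by
  simp only [matrixTensor, Matrix.trace, Matrix.diag_apply, Matrix.of_apply]
  exact (Fintype.prod_sum fun k l => ρ k l l).symm

theorem isHermitian_matrixTensor {ρ : Fin n → Matrix d d ℂ} (h : ∀ k, (ρ k).IsHermitian) :
    (matrixTensor ρ).IsHermitian := by
  ext i j
  simp only [matrixTensor, Matrix.conjTranspose_apply, Matrix.of_apply, star_prod]
  exact Finset.prod_congr rfl fun k _ => (h k).apply _ _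

end MatrixTensor

section Trace

variable {m : Type*} [Fintype m]

theorem re_trace_mul_mul_comm {A B T : Matrix m m ℂ} (hA : A.IsHermitian) (hB : B.IsHermitian)
    (hT : T.IsHermitian) : (B * T * A).trace.re = (A * T * B).trace.re := by
  have : (A * T * B)ᴴ = B * T * A := by
    simp [Matrix.conjTranspose_mul, hA.eq, hB.eq, hT.eq, Matrix.mul_assoc]
  rw [← this, Matrix.trace_conjTranspose]
  simp

/-- A Cauchy-Schwarz inequality for the form `(A, B) ↦ Tr (A T B)`, with a free parameter `s`. -/
theorem two_mul_re_trace_mul_mul_le {A B T : Matrix m m ℂ} (hA : A.IsHermitian)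
    (hB : B.IsHermitian) (hT : T.PosSemidef) (s : ℝ) :
    2 * s * (A * T * B).trace.re ≤ s ^ 2 * (A * A * T).trace.re + (B * B * T).trace.re := by
  -- Expand `Tr ((sA - B) T (sA - B)) ≥ 0`.
  have h := (hT.conjTranspose_mul_mul_same ((s : ℂ) • A - B)).trace_nonneg
  have hconj := re_trace_mul_mul_comm hA hB hT.1
  have hAA : (A * T * A).trace = (A * A * T).trace := Matrix.trace_mul_cycle _ _ _
  have hBB : (B * T * B).trace = (B * B * T).trace := Matrix.trace_mul_cycle _ _ _
  have hre := (Complex.le_def.1 h).1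
  simp only [Matrix.conjTranspose_sub, Matrix.conjTranspose_smul, hA.eq, hB.eq, Matrix.sub_mul,
    Matrix.mul_sub, Matrix.smul_mul, Matrix.mul_smul, Matrix.trace_sub, Matrix.trace_smul, hAA,
    hBB, Complex.star_def, Complex.conj_ofReal, smul_eq_mul, Complex.sub_re, Complex.re_ofReal_mul,
    Complex.zero_re, hconj] at hre
  linarith

/-- If the test `T` distinguishes the states `A²` and `B²` with both errors at most `s²`, then
`Tr (A B) ≤ 2 s`. -/
theorem re_trace_mul_le_of_test [DecidableEq m] {A B T : Matrix m m ℂ} (hA : A.IsHermitian)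
    (hB : B.IsHermitian) (hAtr : (A * A).trace = 1) (hBtr : (B * B).trace = 1)
    (hT : T.PosSemidef) (hT' : (1 - T).PosSemidef) {s : ℝ} (hs : 0 < s)
    (h₁ : 1 - s ^ 2 ≤ (A * A * T).trace.re) (h₂ : (B * B * T).trace.re ≤ s ^ 2) :
    (A * B).trace.re ≤ 2 * s := by
  have nonneg {M S : Matrix m m ℂ} (hM : M.IsHermitian) (hS : S.PosSemidef) :
      0 ≤ (M * M * S).trace.re := by
    simpa using two_mul_re_trace_mul_mul_le (A := 0) Matrix.isHermitian_zero hM hS 0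
  have split (M : Matrix m m ℂ) (hM : (M * M).trace = 1) :
      (M * M * (1 - T)).trace.re = 1 - (M * M * T).trace.re := by
    simp [Matrix.mul_sub, Matrix.trace_sub, hM]
  have hA' := nonneg hA hT'
  have hB' := nonneg hB hT
  -- Insert `1 = T + (1 - T)`. In each half the weight `s ^ 2` falls on the state with the large
  -- probability, the other being at most `s ^ 2`, so each half is at most `s`.
  have hAB : (A * B).trace.re = (A * T * B).trace.re + (B * (1 - T) * A).trace.re := by
    have : (B * A).trace.re = (A * B).trace.re := by rw [Matrix.trace_mul_comm]
    have h := re_trace_mul_mul_comm hA hB hT.1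
    simp only [Matrix.mul_sub, Matrix.sub_mul, Matrix.mul_one, Matrix.trace_sub, Complex.sub_re]
    linarith
  have k₁ := two_mul_re_trace_mul_mul_le hA hB hT s
  have k₂ := two_mul_re_trace_mul_mul_le hB hA hT' s
  rw [split A hAtr] at hA' k₂
  rw [split B hBtr] at k₂
  have e₁ : (A * T * B).trace.re ≤ s := by
    refine le_of_mul_le_mul_left ?_ (by positivity : 0 < 2 * s)
    nlinarith [mul_le_mul_of_nonneg_left hA' (sq_nonneg s)]
  have e₂ : (B * (1 - T) * A).trace.re ≤ s := by
    refine le_of_mul_le_mul_left ?_ (by positivity : 0 < 2 * s)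
    nlinarith [mul_nonneg (sq_nonneg s) hB']
  linarith

/-- Reality of the overlaps lets the real part pass through the product over letters. -/
theorem im_trace_mul_eq_zero {A B : Matrix m m ℂ} (hA : A.IsHermitian) (hB : B.IsHermitian) :
    (A * B).trace.im = 0 := by
  have h : star (A * B).trace = (A * B).trace := by
    rw [← Matrix.trace_conjTranspose, Matrix.conjTranspose_mul, hA.eq, hB.eq,
      Matrix.trace_mul_comm]
  exact Complex.conj_eq_iff_im.1 h

end Trace

section Frobenius

attribute [local instance] Matrix.frobeniusNormedAddCommGroup

variable {m : Type*} [Fintype m]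

theorem Matrix.IsHermitian.frobenius_norm_sq {A : Matrix m m ℂ} (hA : A.IsHermitian) :
    ‖A‖ ^ 2 = (A * A).trace.re := by
  have h : ‖A‖ ^ 2 = ∑ i, ∑ j, ‖A i j‖ ^ 2 := by
    rw [Matrix.frobenius_norm_def, ← Real.sqrt_eq_rpow, Real.sq_sqrt (by positivity)]
    simp
  rw [h]
  simp only [Matrix.trace, Matrix.diag_apply, Matrix.mul_apply, Complex.re_sum]
  refine Finset.sum_congr rfl fun i _ => Finset.sum_congr rfl fun j _ => ?_
  rw [← hA.apply j i, Complex.star_def, Complex.mul_conj, Complex.ofReal_re,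
    Complex.normSq_eq_norm_sq]

theorem frobenius_dist_sq_of_isHermitian {A B : Matrix m m ℂ} (hA : A.IsHermitian)
    (hB : B.IsHermitian) (hAtr : (A * A).trace = 1) (hBtr : (B * B).trace = 1) :
    dist A B ^ 2 = 2 - 2 * (A * B).trace.re := by
  rw [dist_eq_norm, (hA.sub hB).frobenius_norm_sq]
  simp only [Matrix.mul_sub, Matrix.sub_mul, Matrix.trace_sub, hAtr, hBtr,
    Matrix.trace_mul_comm B A, Complex.sub_re, Complex.one_re]
  ring

/-- A family of Hermitian matrices of Hilbert-Schmidt norm one has finite covering numbers, and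
these are attained by a partition of the index set in which the matrices of a common cell overlap
well. -/
theorem exists_cells_of_isHermitian {X : Type*} (f : X → Matrix m m ℂ)
    (hf : ∀ x, (f x).IsHermitian) (hf' : ∀ x, (f x * f x).trace = 1) {δ : ℝ} (hδ : 0 < δ) :
    hsCoveringNumber δ (Set.range f) ≠ ⊤ ∧
      ∃ c : X → Fin (hsCoveringNumber δ (Set.range f)).toNat,
        ∀ x y, c x = c y → 1 - 2 * δ ^ 2 ≤ (f x * f y).trace.re := by
  let _ : NormedSpace ℂ (Matrix m m ℂ) := Matrix.frobeniusNormedSpace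
  have : ProperSpace (Matrix m m ℂ) := FiniteDimensional.proper ℂ _
  have hdef : hsCoveringNumber δ (Set.range f)
    = Metric.coveringNumber δ.toNNReal (Set.range f) := rfl
  have hbdd : Set.range f ⊆ Metric.closedBall 0 1 := by
    rintro _ ⟨x, rfl⟩
    have h := (hf x).frobenius_norm_sq
    rw [hf' x, Complex.one_re] at h
    rw [mem_closedBall_zero_iff]
    nlinarith [norm_nonneg (f x)]
  have htop : hsCoveringNumber δ (Set.range f) ≠ ⊤ := by
    obtain ⟨K, hK, hfin, hcov⟩ := Metric.exists_finite_isCover_of_totallyBounded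
      (Real.toNNReal_pos.2 hδ).ne' ((isCompact_closedBall _ _).totallyBounded.subset hbdd)
    exact ((hcov.coveringNumber_le_encard hK).trans_lt hfin.encard_lt_top).ne
  refine ⟨htop, ?_⟩
  obtain ⟨K, hK, hfin, hcov, hcard⟩ := Metric.exists_set_encard_eq_coveringNumber htop
  have hcard' : K.ncard = (hsCoveringNumber δ (Set.range f)).toNat := by
    rw [hdef, ← hcard, Set.ncard_def]
  have := hfin.to_subtype
  have key (x : X) : ∃ y : K, dist (f x) y ≤ δ := by
    obtain ⟨y, hy, hxy⟩ := hcov ⟨x, rfl⟩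
    refine ⟨⟨y, hy⟩, ?_⟩
    have h : edist (f x) y ≤ (δ.toNNReal : ENNReal) := hxy
    rw [edist_dist] at h
    exact (ENNReal.ofReal_le_ofReal_iff hδ.le).1 h
  choose c hc using key
  refine ⟨fun x => (Finite.equivFinOfCardEq (by rw [← hcard', Nat.card_coe_set_eq])) (c x),
    fun x y hxy => ?_⟩
  have hxy' : c x = c y := (Equiv.injective _) hxy
  -- Both points are within `δ` of the same centre.
  have hd : dist (f x) (f y) ≤ 2 * δ := by
    have h₁ := hc x
    have h₂ := hc y
    rw [← hxy'] at h₂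
    linarith [dist_triangle_right (f x) (f y) (c x : Matrix m m ℂ)]
  have h := frobenius_dist_sq_of_isHermitian (hf x) (hf y) (hf' x) (hf' y)
  nlinarith [dist_nonneg (x := f x) (y := f y)]

end Frobenius

section ErrorExponent

theorem le_rpow_of_le_errorExponent {b E lam : ℝ} (hb : 1 < b) {n : ℕ} (hn : 0 < n)
    (h : (E : EReal) ≤ errorExponent b n lam) : lam ≤ b ^ (-(n * E)) := by
  unfold errorExponent at h
  split_ifs at h with hlam
  · exact hlam.trans (Real.rpow_nonneg (by linarith) _)
  · push Not at hlam
    have hn' : (0 : ℝ) < n := by exact_mod_cast hn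
    rw [EReal.coe_le_coe_iff, one_div_mul_eq_div, le_div_iff₀ hn', one_div, Real.logb_inv] at h
    rw [← Real.logb_le_iff_le_rpow hb hlam]
    linarith

end ErrorExponent

namespace CQChannel

variable {X d : Type*} [Fintype d] [DecidableEq d] (W : CQChannel X d)

theorem sqrt_state_isHermitian (x : X) : (CFC.sqrt (W.state x)).IsHermitian :=
  (Matrix.nonneg_iff_posSemidef.1 (CFC.sqrt_nonneg (W.state x))).1

theorem sqrt_state_mul_self (x : X) : CFC.sqrt (W.state x) * CFC.sqrt (W.state x) = W.state x :=
  CFC.sqrt_mul_sqrt_self _ (Matrix.nonneg_iff_posSemidef.2 (W.isDensityMatrix x).1)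

variable {W} {n N : ℕ} {lam₁ lam₂ : ℝ}

/-- Some letters of two distinct code words of a code with small errors have square roots of output
states of small overlap. -/
theorem DICode.exists_re_trace_sqrt_le (C : W.DICode n N lam₁ lam₂) (hn : 0 < n) {s r : ℝ}
    (hs : 0 < s) (hr : 0 < r) (h₁ : lam₁ ≤ s ^ 2) (h₂ : lam₂ ≤ s ^ 2) (hsr : 2 * s ≤ r ^ n) {j k : Fin N}
    (hjk : j ≠ k) :
    ∃ i, (CFC.sqrt (W.state (C.word j i)) * CFC.sqrt (W.state (C.word k i))).trace.re ≤ r := by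
  by_contra! hlt
  have htr (u : Fin n → X) : (W.wordState u).trace = 1 := by
    rw [wordState, trace_matrixTensor]
    exact Finset.prod_eq_one fun i _ => (W.isDensityMatrix _).2
  have hsq (u : Fin n → X) : (matrixTensor fun i => CFC.sqrt (W.state (u i))) *
      (matrixTensor fun i => CFC.sqrt (W.state (u i))) = W.wordState u := by
    rw [matrixTensor_mul, wordState]
    simp only [sqrt_state_mul_self]
  have hherm (u : Fin n → X) : (matrixTensor fun i => CFC.sqrt (W.state (u i))).IsHermitian :=
    isHermitian_matrixTensor fun i => W.sqrt_state_isHermitian _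
  have hle := re_trace_mul_le_of_test (hherm (C.word j)) (hherm (C.word k))
    (by rw [hsq, htr]) (by rw [hsq, htr]) (C.test_nonneg j) (C.test_le_one j) hs
    (by rw [hsq]; linarith [C.missed_le j]) (by rw [hsq]; linarith [C.wrong_le k j hjk.symm])
  have hprod : ((matrixTensor fun i => CFC.sqrt (W.state (C.word j i))) *
      (matrixTensor fun i => CFC.sqrt (W.state (C.word k i)))).trace.re =
      ∏ i, (CFC.sqrt (W.state (C.word j i)) * CFC.sqrt (W.state (C.word k i))).trace.re := by
    rw [matrixTensor_mul, trace_matrixTensor, ← Complex.ofReal_re (∏ i, _), Complex.ofReal_prod]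
    congr 1
    refine Finset.prod_congr rfl fun i _ => Complex.ext (by simp) ?_
    simpa using im_trace_mul_eq_zero (W.sqrt_state_isHermitian _) (W.sqrt_state_isHermitian _)
  have : Nonempty (Fin n) := ⟨⟨0, hn⟩⟩
  -- If all letter overlaps exceeded `r`, the word overlap would exceed `r ^ n ≥ 2 * s`.
  have hpow := Finset.prod_lt_prod_of_nonempty (s := (Finset.univ : Finset (Fin n)))
    (fun _ _ => hr) (fun i _ => hlt i) Finset.univ_nonempty
  rw [Finset.prod_const, Finset.card_univ, Fintype.card_fin] at hpow
  linarith

end CQChannel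

theorem theorem8 {X d : Type*} [Nonempty X] [Fintype d] [DecidableEq d] (W : CQChannel X d)
    (n N : ℕ) (lam₁ lam₂ : ℝ) (C : W.DICode n N lam₁ lam₂)
    (b : ℝ) (hb : 1 < b) (E : ℝ) (hE : 0 < E)
    (hE₁ : (E : EReal) ≤ errorExponent b n lam₁)
    (hE₂ : (E : EReal) ≤ errorExponent b n lam₂)
    (hn : 4 * b ^ (-(n * E)) ≤ Real.exp (-(n * E / 2))) :
    hsCoveringNumber (1 / 2 * √(1 - Real.exp (-E / 2))) W.sqrtOutputs ≠ ⊤ ∧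
      codeRate n N ≤ Real.logb 2
        (hsCoveringNumber (1 / 2 * √(1 - Real.exp (-E / 2))) W.sqrtOutputs).toNat := by
  -- At `n = 0` the hypothesis `hn` would read `4 ≤ 1`.
  have hn₀ : 0 < n := by
    by_contra h
    obtain rfl : n = 0 := by omega
    norm_num at hn
  -- `q` is the overlap threshold per letter: taking square roots in `hn` gives `2 * s ≤ q ^ n` for
  -- `s ^ 2 = b ^ (-(n * E))`.
  set q := Real.exp (-(E / 4)) with hq
  have hq₀ : 0 < q := Real.exp_pos _
  have hq₁ : q < 1 := Real.exp_zero ▸ Real.exp_lt_exp.2 (by linarith)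
  have hqE : Real.exp (-E / 2) = q ^ 2 := by
    rw [hq, ← Real.exp_nat_mul]
    congr 1
    push_cast
    ring
  have hqn : Real.exp (-(n * E / 2)) = (q ^ n) ^ 2 := by
    rw [hq, ← pow_mul, ← Real.exp_nat_mul]
    congr 1
    push_cast
    ring
  have hε : 0 < b ^ (-(n * E)) := Real.rpow_pos_of_pos (by linarith) _
  have hs := Real.sq_sqrt hε.le
  have hsr : 2 * √(b ^ (-(n * E))) ≤ q ^ n := by
    refine le_of_sq_le_sq ?_ (by positivity)
    rw [mul_pow, hs, ← hqn]
    linarith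
  have hδ₀ : 0 < 1 - Real.exp (-E / 2) := by
    rw [hqE]
    nlinarith
  set δ := 1 / 2 * √(1 - Real.exp (-E / 2)) with hδ
  have hδ' : 0 < δ := by positivity
  -- Here `1 - 2 * δ ^ 2 = (1 + q ^ 2) / 2`, which exceeds `q` by `(1 - q) ^ 2 / 2`.
  have hδq : q < 1 - 2 * δ ^ 2 := by
    rw [hδ, mul_pow, Real.sq_sqrt hδ₀.le, hqE]
    nlinarith [mul_pos (sub_pos.2 hq₁) (sub_pos.2 hq₁)]
  obtain ⟨htop, c, hc⟩ := exists_cells_of_isHermitian (fun x => CFC.sqrt (W.state x))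
    W.sqrt_state_isHermitian
    (fun x => by rw [W.sqrt_state_mul_self]; exact (W.isDensityMatrix x).2) hδ'
  refine ⟨htop, ?_⟩
  change codeRate n N ≤ Real.logb 2 (hsCoveringNumber δ
    (Set.range fun x => CFC.sqrt (W.state x))).toNat
  have hM := (c (Classical.arbitrary X)).pos
  have hinj : Function.Injective fun j i => c (C.word j i) := by
    intro j k hjk
    by_contra hne
    obtain ⟨i, hi⟩ := C.exists_re_trace_sqrt_le hn₀ (Real.sqrt_pos.2 hε) hq₀
      ((le_rpow_of_le_errorExponent hb hn₀ hE₁).trans_eq hs.symm)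
      ((le_rpow_of_le_errorExponent hb hn₀ hE₂).trans_eq hs.symm) hsr hne
    linarith [hc _ _ (congrFun hjk i)]
  have hN := Fintype.card_le_of_injective _ hinj
  rw [Fintype.card_fin, Fintype.card_fun, Fintype.card_fin, Fintype.card_fin] at hN
  have hn' : (0 : ℝ) < n := by exact_mod_cast hn₀
  rw [codeRate, one_div_mul_eq_div, div_le_iff₀' hn', ← Real.logb_pow]
  -- For `N = 0` the convention `log 0 = 0` leaves `0 ≤ log Γ ^ n`, true since a nonempty alphabet
  -- gives `Γ ≥ 1`.
  rcases Nat.eq_zero_or_pos N with rfl | hN₀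
  · simp only [Nat.cast_zero, Real.logb_zero]
    exact Real.logb_nonneg one_lt_two (one_le_pow₀ (by exact_mod_cast hM))
  · exact Real.logb_le_logb_of_le one_lt_two (by exact_mod_cast hN₀) (by exact_mod_cast hN)
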